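/- Let $n>1$ be an integer. There is no $(2n+1)$-dimensional $\phi$-recurrent contact metric manifold of constant curvature. Here manifolds, tensor fields and forms are smooth, and the following definitions are used. A contact metric manifold of dimension $2n+1$ is a manifold $M^{2n+1}$ with a Riemannian metric $g$, a $1$-form $\eta$ with $\eta\wedge(d\eta)^n\neq 0$ everywhere, the vector field $\xi$ determined by $\eta(\xi)=1$ and $d\eta(\xi,\cdot)=0$, and a $(1,1)$-tensor field $\phi$ such that for all vector fields $X,Y$ $$\eta(X)=g(X,\xi),\qquad d\eta(X,Y)=g(X,\phi Y),\qquad \phi^2X=-X+\eta(X)\xi,$$ where $2\,d\eta(X,Y)=X(\eta(Y))-Y(\eta(X))-\eta([X,Y])$. Let $\nabla$ be the Levi-Civita connection of $g$ and $R(X,Y)Z=\nabla_X\nabla_YZ-\nabla_Y\nabla_XZ-\nabla_{[X,Y]}Z$. The manifold has constant curvature if there is a real constant $\lambda$ with $R(X,Y)Z=\lambda\,(g(Y,Z)X-g(X,Z)Y)$ for all vector fields $X,Y,Z$. It is $\phi$-recurrent if there is a $1$-form $A$, not identically zero, such that $$\phi^2\big((\nabla_WR)(X,Y)Z\big)=A(W)\,R(X,Y)Z$$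 for all vector fields $X,Y,Z,W$. -/

import Mathlib

open Bundle VectorField
open scoped Manifold ContDiff

noncomputable section

namespace ContactGeometry

set_option linter.unusedSectionVars false

section LeviCivita

variable {E : Type*} [NormedAddCommGroup E] [NormedSpace ℝ E] [FiniteDimensional ℝ E] [CompleteSpace E]
  {H : Type*} [TopologicalSpace H] {I : ModelWithCorners ℝ E H}
  {M : Type*} [TopologicalSpace M] [ChartedSpace H M] [IsManifold I 2 M]
  [RiemannianBundle (fun x : M ↦ TangentSpace I x)]
  [IsContMDiffRiemannianBundle I 1 E (fun x : M ↦ TangentSpace I x)]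

/-- The right-hand side of the Koszul formula for `2 g(∇_X Y, Z)` at `x`. -/
def koszul (Y X Z : Π x : M, TangentSpace I x) (x : M) : ℝ :=
  d% (fun y ↦ inner ℝ (Y y) (Z y)) x (X x)
    + d% (fun y ↦ inner ℝ (Z y) (X y)) x (Y x)
    - d% (fun y ↦ inner ℝ (X y) (Y y)) x (Z x)
    - inner ℝ (X x) (mlieBracket I Y Z x)
    - inner ℝ (Y x) (mlieBracket I X Z x)
    + inner ℝ (Z x) (mlieBracket I X Y x)


theorem mdifferentiableAt_inner {X Y : Π x : M, TangentSpace I x} {x : M}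
    (hX : MDiffAt (T% X) x) (hY : MDiffAt (T% Y) x) :
    MDiffAt (fun y ↦ (inner ℝ (X y) (Y y) : ℝ)) x :=
  MDifferentiableAt.inner_bundle (F := E) (E := fun x : M ↦ TangentSpace I x)
    (b := fun y : M ↦ y) hX hY

theorem koszul_tensorial_left {Y Z : Π x : M, TangentSpace I x} {x : M}
    (hY : MDiffAt (T% Y) x) (hZ : MDiffAt (T% Z) x) :
    TensorialAt I E (koszul Y · Z x) x where
  smul {f X} hf hX := by
    have h1 := mdifferentiableAt_inner hZ hX
    have h2 := mdifferentiableAt_inner hX hY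
    simp [koszul, inner_smul_left, inner_smul_right, mvfderiv_fun_mul hf h1,
      mvfderiv_fun_mul hf h2, mlieBracket_smul_left hf hX, inner_add_right]
    simp [real_inner_comm]
    ring
  add {X X'} hX hX' := by
    simp [koszul, inner_add_left, inner_add_right,
      mvfderiv_fun_add (mdifferentiableAt_inner hZ hX) (mdifferentiableAt_inner hZ hX'),
      mvfderiv_fun_add (mdifferentiableAt_inner hX hY) (mdifferentiableAt_inner hX' hY),
      mlieBracket_add_left hX hX']
    ring

theorem koszul_tensorial_right {Y X : Π x : M, TangentSpace I x} {x : M}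
    (hY : MDiffAt (T% Y) x) (hX : MDiffAt (T% X) x) :
    TensorialAt I E (koszul Y X · x) x where
  smul {f Z} hf hZ := by
    simp [koszul, inner_smul_left, inner_smul_right, mvfderiv_fun_mul hf (mdifferentiableAt_inner hY hZ),
      mvfderiv_fun_mul hf (mdifferentiableAt_inner hZ hX), mlieBracket_smul_right hf hZ, inner_add_right]
    simp [real_inner_comm]
    ring
  add {Z Z'} hZ hZ' := by
    simp [koszul, inner_add_left, inner_add_right,
      mvfderiv_fun_add (mdifferentiableAt_inner hY hZ) (mdifferentiableAt_inner hY hZ'),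
      mvfderiv_fun_add (mdifferentiableAt_inner hZ hX) (mdifferentiableAt_inner hZ' hX),
      mlieBracket_add_right hZ hZ']
    ring

theorem completeSpace_tangentSpace (x : M) : CompleteSpace (TangentSpace I x) := by
  have : FiniteDimensional ℝ (TangentSpace I x) := inferInstanceAs (FiniteDimensional ℝ E)
  exact FiniteDimensional.complete ℝ (TangentSpace I x)

open Classical in
/-- `∇ Y` at `x`, as the linear map `X ↦ ∇_X Y`, obtained from the Koszul formula by duality;
junk value `0` where `Y` is not differentiable. -/
def leviCivitaFun (Y : Π x : M, TangentSpace I x) (x : M) :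
    TangentSpace I x →L[ℝ] TangentSpace I x :=
  haveI := completeSpace_tangentSpace (I := I) x
  if hY : MDiffAt (T% Y) x then
    (1 / 2 : ℝ) • InnerProductSpace.continuousLinearMapOfBilin (𝕜 := ℝ)
      (TensorialAt.mkHom₂ (koszul Y · · x) x
        (fun _ hZ ↦ koszul_tensorial_left hY hZ)
        (fun _ hX ↦ koszul_tensorial_right hY hX))
  else 0

/-- The Koszul formula. -/
theorem inner_leviCivitaFun {Y X Z : Π x : M, TangentSpace I x} {x : M}
    (hY : MDiffAt (T% Y) x) (hX : MDiffAt (T% X) x) (hZ : MDiffAt (T% Z) x) :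
    inner ℝ (leviCivitaFun Y x (X x)) (Z x) = koszul Y X Z x / 2 := by
  have := completeSpace_tangentSpace (I := I) x
  have key := TensorialAt.mkHom₂_apply (Φ := (koszul Y · · x))
    (fun _ hZ ↦ koszul_tensorial_left hY hZ) (fun _ hX ↦ koszul_tensorial_right hY hX) hX hZ
  rw [leviCivitaFun, dif_pos hY, smul_apply, inner_smul_left,
    InnerProductSpace.continuousLinearMapOfBilin_apply]
  erw [key]
  simp; ring

theorem eq_of_inner_extend {x : M} {L L' : TangentSpace I x →L[ℝ] TangentSpace I x}
    (h : ∀ X Z : Π x : M, TangentSpace I x, MDiffAt (T% X) x → MDiffAt (T% Z) x →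
      (inner ℝ (L (X x)) (Z x) : ℝ) = inner ℝ (L' (X x)) (Z x)) : L = L' := by
  ext1 v
  refine ext_inner_right ℝ fun w ↦ ?_
  have := h (FiberBundle.extend E v) (FiberBundle.extend E w)
    (FiberBundle.mdifferentiableAt_extend ..) (FiberBundle.mdifferentiableAt_extend ..)
  simpa using this

variable (I M) in
/-- The Levi-Civita connection of a Riemannian manifold. -/
def leviCivita : CovariantDerivative I E (TangentSpace I : M → Type _) where
  toFun := leviCivitaFun
  isCovariantDerivativeOnUniv :=
    { add := by
        intro σ σ' x hσ hσ' _
        refine eq_of_inner_extend fun X Z hX hZ ↦ ?_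
        rw [inner_leviCivitaFun (mdifferentiableAt_add_section hσ hσ') hX hZ, add_apply,
          inner_add_left, inner_leviCivitaFun hσ hX hZ, inner_leviCivitaFun hσ' hX hZ]
        simp [koszul, inner_add_left, inner_add_right,
          mvfderiv_fun_add (mdifferentiableAt_inner hσ hZ) (mdifferentiableAt_inner hσ' hZ),
          mvfderiv_fun_add (mdifferentiableAt_inner hX hσ) (mdifferentiableAt_inner hX hσ'),
          mlieBracket_add_left hσ hσ', mlieBracket_add_right hσ hσ']
        ring
      leibniz := by
        intro σ f x hσ hf _
        refine eq_of_inner_extend fun X Z hX hZ ↦ ?_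
        rw [inner_leviCivitaFun (hf.smul_section hσ) hX hZ, add_apply,
          inner_add_left, smul_apply, inner_smul_left,
          inner_leviCivitaFun hσ hX hZ]
        simp [koszul, inner_smul_left, inner_smul_right,
          mvfderiv_fun_mul hf (mdifferentiableAt_inner hσ hZ),
          mvfderiv_fun_mul hf (mdifferentiableAt_inner hX hσ),
          mlieBracket_smul_left hf hσ, mlieBracket_smul_right hf hσ, inner_add_right]
        simp [real_inner_comm]
        ring }

/-- The Levi-Civita connection is torsion-free. -/
theorem leviCivita_torsion : (leviCivita I M).torsion = 0 := by
  rw [CovariantDerivative.torsion_eq_zero_iff]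
  intro X Y x hX hY
  refine ext_inner_right ℝ fun w ↦ ?_
  have hZ : MDiffAt (T% (FiberBundle.extend E w : Π x : M, TangentSpace I x)) x :=
    FiberBundle.mdifferentiableAt_extend ..
  have h1 := inner_leviCivitaFun hY hX hZ
  have h2 := inner_leviCivitaFun hX hY hZ
  have h3 : mlieBracket I Y X x = - mlieBracket I X Y x := by rw [mlieBracket_swap]; rfl
  simp only [FiberBundle.extend_apply_self] at h1 h2
  rw [inner_sub_left]
  refine (congrArg₂ (· - ·) h1 h2).trans ?_
  simp only [koszul, h3, inner_neg_right, FiberBundle.extend_apply_self]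
  simp only [real_inner_comm]
  ring

/-- The Levi-Civita connection is compatible with the metric. -/
theorem leviCivita_metric {X Y Z : Π x : M, TangentSpace I x} {x : M}
    (hX : MDiffAt (T% X) x) (hY : MDiffAt (T% Y) x) (hZ : MDiffAt (T% Z) x) :
    d% (fun y ↦ (inner ℝ (Y y) (Z y) : ℝ)) x (X x) =
      inner ℝ (leviCivita I M Y x (X x)) (Z x) + inner ℝ (Y x) (leviCivita I M Z x (X x)) := by
  have h1 := inner_leviCivitaFun hY hX hZ
  have h2 := inner_leviCivitaFun hZ hX hY
  have h3 : mlieBracket I Z Y x = - mlieBracket I Y Z x := by rw [mlieBracket_swap]; rfl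
  rw [real_inner_comm (leviCivita I M Z x (X x))]
  refine Eq.trans ?_ (congrArg₂ (· + ·) h1 h2).symm
  simp only [koszul, h3, inner_neg_right]
  simp only [real_inner_comm]
  ring

end LeviCivita

section Smooth

variable {E : Type*} [NormedAddCommGroup E] [NormedSpace ℝ E]
  {H : Type*} [TopologicalSpace H] (I : ModelWithCorners ℝ E H)
  (M : Type*) [TopologicalSpace M] [ChartedSpace H M] [IsManifold I ∞ M]

/-- Smooth vector fields on `M`. -/
abbrev SmoothVectorField : Type _ :=
  ContMDiffSection I E ∞ (fun x : M ↦ TangentSpace I x)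

variable {M}

/-- Smooth 1-forms, as smooth sections of the cotangent bundle. -/
def IsSmoothOneForm (α : Π x : M, TangentSpace I x →L[ℝ] ℝ) : Prop :=
  ContMDiff I (I.prod 𝓘(ℝ, E →L[ℝ] ℝ)) ∞
    (fun x ↦ (⟨x, α x⟩ : TotalSpace (E →L[ℝ] ℝ)
      (fun y : M ↦ TangentSpace I y →L[ℝ] Bundle.Trivial M ℝ y)))

/-- Smooth (1,1)-tensor fields, as smooth sections of the endomorphism bundle of `TM`. -/
def IsSmoothEndomorphism (φ : Π x : M, TangentSpace I x →L[ℝ] TangentSpace I x) : Prop :=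
  ContMDiff I (I.prod 𝓘(ℝ, E →L[ℝ] E)) ∞
    (fun x ↦ (⟨x, φ x⟩ : TotalSpace (E →L[ℝ] E)
      (fun y : M ↦ TangentSpace I y →L[ℝ] TangentSpace I y)))

/-- The exterior derivative of a 1-form, with the normalization
`2 dη(X, Y) = X(η(Y)) - Y(η(X)) - η([X, Y])` customary in contact metric geometry. -/
def extDerivOneForm (η : Π x : M, TangentSpace I x →L[ℝ] ℝ)
    (X Y : Π x : M, TangentSpace I x) (x : M) : ℝ :=
  (1 / 2 : ℝ) * (d% (fun y ↦ η y (Y y)) x (X x) - d% (fun y ↦ η y (X y)) x (Y x)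
    - η x (mlieBracket I X Y x))

/-- The value of the top-degree form `η ∧ (dη)ⁿ` at `x` on the vector fields `v 0, …, v (2n)`,
up to a positive normalization factor depending only on `n`. -/
def wedgePower (n : ℕ) (η : Π x : M, TangentSpace I x →L[ℝ] ℝ)
    (v : Fin (2 * n + 1) → Π x : M, TangentSpace I x) (x : M) : ℝ :=
  ∑ σ : Equiv.Perm (Fin (2 * n + 1)), ((Equiv.Perm.sign σ : ℤ) : ℝ) *
    (η x (v (σ ⟨0, by omega⟩) x) * ∏ i : Fin n,
      extDerivOneForm I η (v (σ ⟨2 * i + 1, by omega⟩)) (v (σ ⟨2 * i + 2, by omega⟩)) x)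

/-- A contact form on a `(2n+1)`-dimensional manifold: a global smooth 1-form `η` such that
`η ∧ (dη)ⁿ` vanishes nowhere. -/
structure IsContactForm (n : ℕ) (η : Π x : M, TangentSpace I x →L[ℝ] ℝ) : Prop where
  smooth : IsSmoothOneForm I η
  wedge_ne_zero : ∀ x : M, ∃ v : Fin (2 * n + 1) → SmoothVectorField I M,
    wedgePower I n η (fun i ↦ v i) x ≠ 0

end Smooth

section ContactMetric

variable {E : Type*} [NormedAddCommGroup E] [NormedSpace ℝ E] [FiniteDimensional ℝ E]
  [CompleteSpace E]
  {H : Type*} [TopologicalSpace H] (I : ModelWithCorners ℝ E H)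
  {M : Type*} [TopologicalSpace M] [ChartedSpace H M] [IsManifold I ∞ M]
  [RiemannianBundle (fun x : M ↦ TangentSpace I x)]
  [IsContMDiffRiemannianBundle I ∞ E (fun x : M ↦ TangentSpace I x)]

/-- `∇_X Y` for the Levi-Civita connection. -/
def nabla (X Y : Π x : M, TangentSpace I x) (x : M) : TangentSpace I x :=
  leviCivita I M Y x (X x)

/-- The curvature `R(X, Y)Z = ∇_X ∇_Y Z - ∇_Y ∇_X Z - ∇_[X, Y] Z`. -/
def curvature (X Y Z : Π x : M, TangentSpace I x) (x : M) : TangentSpace I x :=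
  nabla I X (nabla I Y Z) x - nabla I Y (nabla I X Z) x - nabla I (mlieBracket I X Y) Z x

/-- The covariant derivative `(∇_W R)(X, Y)Z` of the curvature. -/
def nablaCurvature (W X Y Z : Π x : M, TangentSpace I x) (x : M) : TangentSpace I x :=
  nabla I W (curvature I X Y Z) x - curvature I (nabla I W X) Y Z x
    - curvature I X (nabla I W Y) Z x - curvature I X Y (nabla I W Z) x

variable (M) in
/-- The Riemannian manifold `M` has constant (sectional) curvature `c`. -/
def HasConstantCurvature (c : ℝ) : Prop :=
  ∀ (X Y Z : SmoothVectorField I M) (x : M),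
    curvature I X Y Z x =
      c • ((inner ℝ (Y x) (Z x) : ℝ) • X x - (inner ℝ (X x) (Z x) : ℝ) • Y x)

/-- `(η, ξ, φ)`, together with the Riemannian metric of `M`, is a contact metric structure on the
`(2n+1)`-dimensional manifold `M`: `η` is a contact form with characteristic vector field `ξ`, and
the metric and `φ` are associated to it. -/
structure IsContactMetricStructure (n : ℕ) (η : Π x : M, TangentSpace I x →L[ℝ] ℝ)
    (ξ : SmoothVectorField I M) (φ : Π x : M, TangentSpace I x →L[ℝ] TangentSpace I x) :
    Prop where
  contact : IsContactForm I n η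
  eta_xi : ∀ x : M, η x (ξ x) = 1
  deta_xi : ∀ (X : SmoothVectorField I M) (x : M), extDerivOneForm I η ξ X x = 0
  smooth_phi : IsSmoothEndomorphism I φ
  eta_eq : ∀ (x : M) (u : TangentSpace I x), η x u = inner ℝ u (ξ x)
  deta_eq : ∀ (X Y : SmoothVectorField I M) (x : M),
    extDerivOneForm I η X Y x = inner ℝ (X x) (φ x (Y x))
  phi_sq : ∀ (x : M) (u : TangentSpace I x), φ x (φ x u) = -u + η x u • ξ x

/-- `φ`-recurrence: there is a 1-form `A`, not identically zero, such that
`φ²((∇_W R)(X, Y)Z) = A(W) R(X, Y)Z` for all vector fields `X, Y, Z, W`. -/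
def IsPhiRecurrent (φ : Π x : M, TangentSpace I x →L[ℝ] TangentSpace I x) : Prop :=
  ∃ A : Π x : M, TangentSpace I x →L[ℝ] ℝ, IsSmoothOneForm I A ∧ (∃ x, A x ≠ 0) ∧
    ∀ (X Y Z W : SmoothVectorField I M) (x : M),
      φ x (φ x (nablaCurvature I W X Y Z x)) = A x (W x) • curvature I X Y Z x

end ContactMetric

end ContactGeometry

end

open Bundle VectorField
open scoped Manifold ContDiff

noncomputable section

namespace ContactGeometry

set_option linter.unusedSectionVars false

/-! Constant curvature gives `∇R = 0`, so φ-recurrence reads `A(W) R(X, Y)Z = 0`, and `R` vanishes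
at any point where `A` does not. If the curvature `c` is nonzero, `R(X, ξ)ξ = c (X - η(X) ξ) = 0`
there, so `ξ` spans the tangent space (`finrank_le_one`). If `c = 0`, the contradiction is the
theorem that flat contact metric manifolds have dimension at most 3 (`finrank_le_three`); recurrence
plays no role.

For the flat case put `S X = ∇_X ξ`. The contact condition says that the adjoint of `S` is `S + 2φ`,
and flatness makes `∇S` symmetric (`C_symm`). These yield `Sφ + φS = -2φ²` (`S_phi`), whence `2 Id =
Sφ + φS + 2 η ⊗ ξ` (`two_smul_eq`), and `S² = 0` (`S_S`). So the images of `S` and `φS`, together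
with `ξ`, span everything. A symmetry argument on these images gives `(∇_X S)Y = -g(SX, SY) ξ`
(`C_eq`). Commuting second derivatives of `S` then gives `g(SX, SY) SW = g(SW, SY) SX` (`g_smul_S`):
`S` has rank at most one. If `e` spans its image, then `e`, `φe`, `ξ` span the tangent space.

The tensor computations are done over the ring of smooth functions, which is not a field; hence
division by 2 is replaced by cancellation of 2 (`two_regular`). -/

/-! ### Metric connections and curvature, algebraically. -/

/-- An algebraic model of the Levi-Civita connection acting on the module `V` of vector fields over
the ring `F` of functions. -/
structure MetricCalculus (F V : Type*) [CommRing F] [AddCommGroup V] [Module F V] where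
  /-- the metric -/
  g : V →ₗ[F] V →ₗ[F] F
  /-- directional derivatives of functions -/
  D : V → F → F
  /-- the connection -/
  nab : V → V → V
  g_symm : ∀ X Y, g X Y = g Y X
  g_nondeg : ∀ X, (∀ Z, g X Z = 0) → X = 0
  two_regular : ∀ f : F, 2 * f = 0 → f = 0
  D_add : ∀ X f h, D X (f + h) = D X f + D X h
  D_one : ∀ X, D X 1 = 0
  nab_add_left : ∀ X Y Z, nab (X + Y) Z = nab X Z + nab Y Z
  nab_smul_left : ∀ (f : F) X Z, nab (f • X) Z = f • nab X Z
  nab_add : ∀ X Y Z, nab X (Y + Z) = nab X Y + nab X Z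
  nab_smul : ∀ X (f : F) Z, nab X (f • Z) = f • nab X Z + D X f • Z
  D_g : ∀ X Y Z, D X (g Y Z) = g (nab X Y) Z + g Y (nab X Z)

namespace MetricCalculus

variable {F V : Type*} [CommRing F] [AddCommGroup V] [Module F V] (c : MetricCalculus F V)

/-- The curvature tensor, with the bracket expressed by torsion-freeness. -/
def curv (X Y Z : V) : V :=
  c.nab X (c.nab Y Z) - c.nab Y (c.nab X Z) - c.nab (c.nab X Y - c.nab Y X) Z

/-- The covariant derivative of the curvature tensor. -/
def nabCurv (W X Y Z : V) : V :=
  c.nab W (c.curv X Y Z) - c.curv (c.nab W X) Y Z - c.curv X (c.nab W Y) Z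
    - c.curv X Y (c.nab W Z)

theorem D_zero (X : V) : c.D X 0 = 0 := by
  have := c.D_add X 0 0
  simpa using this

theorem D_neg (X : V) (f : F) : c.D X (-f) = -c.D X f := by
  have := c.D_add X f (-f)
  rw [add_neg_cancel, D_zero] at this
  linear_combination -this

theorem D_sub (X : V) (f h : F) : c.D X (f - h) = c.D X f - c.D X h := by
  rw [sub_eq_add_neg, D_add, D_neg, sub_eq_add_neg]

theorem D_two_mul (X : V) (f : F) : c.D X (2 * f) = 2 * c.D X f := by
  rw [two_mul, D_add, two_mul]

theorem nab_zero (X : V) : c.nab X 0 = 0 := by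
  have := c.nab_add X 0 0
  simpa using this

theorem nab_neg (X Y : V) : c.nab X (-Y) = -c.nab X Y := by
  have := c.nab_add X Y (-Y)
  rw [add_neg_cancel, nab_zero] at this
  linear_combination (norm := module) -this

theorem nab_sub (X Y Z : V) : c.nab X (Y - Z) = c.nab X Y - c.nab X Z := by
  rw [sub_eq_add_neg, nab_add, nab_neg, sub_eq_add_neg]

theorem eq_of_g (c : MetricCalculus F V) {X Y : V} (h : ∀ Z, c.g X Z = c.g Y Z) : X = Y := by
  refine sub_eq_zero.1 (c.g_nondeg _ fun Z ↦ ?_)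
  simp [h Z]

theorem eq_zero_of_two_smul (c : MetricCalculus F V) {X : V} (h : (2 : F) • X = 0) : X = 0 :=
  c.g_nondeg _ fun Z ↦ c.two_regular _ <| by
    have := congrArg (fun Y ↦ c.g Y Z) h
    simpa using this

theorem eq_of_two_smul (c : MetricCalculus F V) {X Y : V} (h : (2 : F) • X = (2 : F) • Y) : X = Y :=
  sub_eq_zero.1 <| c.eq_zero_of_two_smul <| by rw [smul_sub, h, sub_self]

theorem eq_of_two_mul (c : MetricCalculus F V) {f h : F} (e : 2 * f = 2 * h) : f = h :=
  sub_eq_zero.1 <| c.two_regular _ <| by rw [mul_sub, e, sub_self]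

/-- The curvature is built from `g`, which is parallel, and a factor with zero derivative. -/
theorem nabCurv_eq_zero {k : F} (hk : ∀ X, c.D X k = 0)
    (h : ∀ X Y Z, c.curv X Y Z = k • (c.g Y Z • X - c.g X Z • Y)) (W X Y Z : V) :
    c.nabCurv W X Y Z = 0 := by
  simp only [nabCurv, h, nab_smul, nab_sub, hk, D_g]
  module

end MetricCalculus

/-! ### Flat contact metric structures: the identities for `S`, `φ` and their derivatives. -/

/-- An algebraic model of a contact metric structure on a flat Riemannian manifold. -/
structure FlatContactCalculus (F V : Type*) [CommRing F] [AddCommGroup V] [Module F V]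
    extends MetricCalculus F V where
  /-- the characteristic vector field -/
  ξ : V
  /-- the structure tensor -/
  φ : V →ₗ[F] V
  flat : ∀ X Y Z, toMetricCalculus.curv X Y Z = 0
  g_xi_xi : g ξ ξ = 1
  /-- the identity `2 dη(X, Y) = 2 g(X, φ Y)` -/
  deta : ∀ X Y, g (nab X ξ) Y - g (nab Y ξ) X = 2 * g X (φ Y)
  /-- the identity `dη(ξ, X) = 0` -/
  deta_xi : ∀ X, g (nab ξ ξ) X - g (nab X ξ) ξ = 0
  phi_sq : ∀ X, φ (φ X) = -X + g X ξ • ξ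

namespace FlatContactCalculus

variable {F V : Type*} [CommRing F] [AddCommGroup V] [Module F V] (c : FlatContactCalculus F V)

/-- The endomorphism `X ↦ ∇_X ξ`. -/
def S : V →ₗ[F] V where
  toFun X := c.nab X c.ξ
  map_add' X Y := c.nab_add_left X Y _
  map_smul' f X := c.nab_smul_left f X _

theorem nab_xi (X : V) : c.nab X c.ξ = c.S X := rfl

/-- The covariant derivative of `S`. -/
def C (X Y : V) : V := c.nab X (c.S Y) - c.S (c.nab X Y)

/-- The covariant derivative of `φ`. -/
def N (X Y : V) : V := c.nab X (c.φ Y) - c.φ (c.nab X Y)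

theorem nab_S (X Y : V) : c.nab X (c.S Y) = c.C X Y + c.S (c.nab X Y) := by simp [C]

theorem nab_phi (X Y : V) : c.nab X (c.φ Y) = c.N X Y + c.φ (c.nab X Y) := by simp [N]

theorem g_S_xi (X : V) : c.g (c.S X) c.ξ = 0 := by
  have h := c.D_g X c.ξ c.ξ
  rw [c.g_xi_xi, c.D_one, c.g_symm c.ξ, nab_xi] at h
  exact c.two_regular _ (by linear_combination -h)

theorem S_xi : c.S c.ξ = 0 := c.g_nondeg _ fun Z ↦ by
  have h := c.deta_xi Z
  rwa [nab_xi, nab_xi, g_S_xi, sub_zero] at h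

theorem g_S_sub (X Y : V) : c.g (c.S X) Y - c.g (c.S Y) X = 2 * c.g X (c.φ Y) := c.deta X Y

/-- The left side of `g_S_sub` is antisymmetric in `X` and `Y`. -/
theorem g_phi (X Y : V) : c.g (c.φ X) Y = -c.g X (c.φ Y) := by
  rw [c.g_symm]
  exact c.eq_of_two_mul (by linear_combination -c.g_S_sub X Y - c.g_S_sub Y X)

theorem phi_xi : c.φ c.ξ = 0 := c.g_nondeg _ fun Z ↦ by
  rw [c.g_symm]
  have h := c.g_S_sub Z c.ξ
  simp only [g_S_xi, S_xi, map_zero, LinearMap.zero_apply, sub_zero] at h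
  exact c.two_regular _ h.symm

theorem g_phi_xi (X : V) : c.g (c.φ X) c.ξ = 0 := by rw [g_phi, phi_xi, map_zero, neg_zero]

theorem phi_phi_S (X : V) : c.φ (c.φ (c.S X)) = -c.S X := by
  rw [c.phi_sq, g_S_xi, zero_smul, add_zero]

theorem S_phi_phi (X : V) : c.S (c.φ (c.φ X)) = -c.S X := by
  rw [c.phi_sq]; simp [S_xi]

theorem phi_cube (X : V) : c.φ (c.φ (c.φ X)) = -c.φ X := by
  rw [c.phi_sq, g_phi_xi, zero_smul, add_zero]

/-- The adjoint of `S` is `S + 2 φ`. -/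
theorem g_S (X Y : V) : c.g (c.S X) Y = c.g X (c.S Y + (2 : F) • c.φ Y) := by
  rw [map_add, c.g_symm X (c.S Y), map_smul, smul_eq_mul]
  linear_combination c.g_S_sub X Y

/-- The Codazzi equation for `S`. -/
theorem C_symm (X Y : V) : c.C X Y = c.C Y X := by
  have h := c.flat X Y c.ξ
  simp only [MetricCalculus.curv, nab_xi, map_sub] at h
  unfold C
  linear_combination (norm := module) h

theorem C_xi (X : V) : c.C X c.ξ = -c.S (c.S X) := by
  rw [C, S_xi, c.nab_zero, nab_xi, zero_sub]

/-- Derivative of `g (S Y) ξ = 0`. -/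
theorem g_C_xi (X Y : V) : c.g (c.C X Y) c.ξ = -c.g (c.S X) (c.S Y) := by
  have h := c.D_g X (c.S Y) c.ξ
  rw [g_S_xi, c.D_zero, nab_xi, nab_S] at h
  simp only [map_add, LinearMap.add_apply, g_S_xi] at h
  rw [c.g_symm (c.S X)]
  linear_combination -h

/-- Derivative of `g_S_sub`: the antisymmetric part of `∇S` is `∇φ`. -/
theorem g_C_sub (X Y Z : V) :
    c.g (c.C X Y) Z - c.g (c.C X Z) Y = 2 * c.g Y (c.N X Z) := by
  have h := congrArg (c.D X) (c.g_S_sub Y Z)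
  rw [c.D_two_mul, c.D_sub, c.D_g, c.D_g, c.D_g, nab_S, nab_S, nab_phi] at h
  simp only [map_add, LinearMap.add_apply] at h
  linear_combination h - c.g_S_sub (c.nab X Y) Z - c.g_S_sub Y (c.nab X Z)

/-- Derivative of `φ² = -1 + η ⊗ ξ`. -/
theorem phi_N_add (X Y : V) :
    c.φ (c.N X Y) + c.N X (c.φ Y) = c.g Y (c.S X) • c.ξ + c.g Y c.ξ • c.S X := by
  simp only [N, map_sub, c.phi_sq, c.nab_add, c.nab_neg, c.nab_smul, c.D_g, nab_xi]
  module

/-- By Codazzi `∇_ξ S = -S²`, so `g_C_sub` along `ξ` makes `2 ∇_ξ φ` the difference of `S²` and its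
adjoint `(S + 2φ)²`. -/
theorem S_phi_add_aux (X : V) :
    c.N c.ξ X = -(c.S (c.φ X) + c.φ (c.S X)) - (2 : F) • c.φ (c.φ X) := by
  refine c.eq_of_two_smul (c.eq_of_g fun Z ↦ ?_)
  have h := c.g_C_sub c.ξ Z X
  rw [C_symm, C_xi, c.C_symm _ X, C_xi] at h
  have h1 : c.g (c.S (c.S Z)) X = 
      c.g Z (c.S (c.S X + (2 : F) • c.φ X) + (2 : F) • c.φ (c.S X + (2 : F) • c.φ X)) := by
    rw [g_S, g_S]
  rw [c.g_symm _ Z, c.g_symm _ Z]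
  simp only [map_add, map_neg, map_smul, map_sub, smul_eq_mul, LinearMap.neg_apply] at h h1 ⊢
  rw [c.g_symm _ Z] at h
  linear_combination -h - h1

/-- Along `ξ` the right side of `phi_N_add` vanishes because `Sξ = 0`, so `∇_ξ φ` anticommutes with
`φ`; the formula for `∇_ξ φ` is then inserted. -/
theorem phi_S_phi (X : V) : c.φ (c.S (c.φ X)) = c.S X + (2 : F) • c.φ X := by
  have h := c.phi_N_add c.ξ X
  simp only [S_phi_add_aux, map_sub, map_neg, map_add, map_smul, S_xi, phi_phi_S, S_phi_phi,
    phi_cube, map_zero] at h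
  refine c.eq_of_two_smul (F := F) ?_
  linear_combination (norm := module) -h

theorem S_phi (X : V) : c.S (c.φ X) = -c.φ (c.S X) - (2 : F) • c.φ (c.φ X) := by
  have h := congrArg c.φ (c.phi_S_phi X)
  rw [phi_phi_S, map_add, map_smul] at h
  linear_combination (norm := module) -h

theorem N_xi (X : V) : c.N c.ξ X = 0 := by
  rw [S_phi_add_aux, S_phi]; module

/-- Twice the identity splits as `S φ + φ S + 2 η ⊗ ξ`. -/
theorem two_smul_eq (X : V) :
    (2 : F) • X = c.S (c.φ X) + c.φ (c.S X) + (2 : F) • c.g X c.ξ • c.ξ := by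
  rw [S_phi, c.phi_sq]; module

/-- Differentiating `S_phi` along `ξ`, with `∇_ξ φ = 0` and `∇_ξ S = -S²`, shows that `S²`
anticommutes with `φ`. Applying `S_phi` twice shows that they commute. So `φS² = 0`, and another `φ`
removes the factor. -/
theorem S_S (X : V) : c.S (c.S X) = 0 := by
  have e := congrArg (c.nab c.ξ) (c.S_phi X)
  have e2 := c.S_phi (c.nab c.ξ X)
  have d2 : c.D c.ξ 2 = 0 := by
    rw [← one_add_one_eq_two, c.D_add, c.D_one, add_zero]
  rw [c.nab_sub, c.nab_neg, c.nab_smul, d2] at e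
  simp only [nab_S, nab_phi, N_xi, map_add, c.C_symm c.ξ, C_xi, map_neg, map_zero] at e
  have e3 : c.S (c.S (c.φ X)) = c.φ (c.S (c.S X)) := by
    simp only [S_phi, map_sub, map_neg, map_smul, phi_phi_S]
    module
  have e4 : c.φ (c.S (c.S X)) = 0 := by
    refine c.eq_zero_of_two_smul ?_
    linear_combination (norm := module) e2 - e - e3
  have e5 := c.phi_phi_S (c.S X)
  rw [e4, map_zero] at e5
  linear_combination (norm := module) e5

theorem S_phi_S (X : V) : c.S (c.φ (c.S X)) = (2 : F) • c.S X := by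
  rw [S_phi, S_S, phi_phi_S, map_zero]; module

theorem C_S (X Y : V) : c.C X (c.S Y) = -c.S (c.C X Y) := by
  have h := congrArg (c.nab X) (c.S_S Y)
  rw [c.nab_zero, nab_S, nab_S, map_add, S_S] at h
  linear_combination (norm := module) h

/-! ### Vanishing of `T`, and the rank of `S`. -/

/-- The trilinear form `g(∇_X S Y, Z) + g(S X, S Y) η(Z)`; it vanishes identically. -/
def T (X Y : V) : V →ₗ[F] F := c.g (c.C X Y + c.g (c.S X) (c.S Y) • c.ξ)

theorem T_apply (X Y Z : V) :
    c.T X Y Z = c.g (c.C X Y) Z + c.g (c.S X) (c.S Y) * c.g c.ξ Z := by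
  simp [T]

theorem T_symm (X Y Z : V) : c.T X Y Z = c.T Y X Z := by
  rw [T, T, C_symm, c.g_symm (c.S X)]

theorem C_add_left (X Y Z : V) : c.C (X + Y) Z = c.C X Z + c.C Y Z := by
  simp only [C, c.nab_add_left, map_add]; module

theorem C_smul_left (f : F) (X Z : V) : c.C (f • X) Z = f • c.C X Z := by
  simp only [C, c.nab_smul_left, map_smul]; module

theorem T_add_left (X Y Z W : V) : c.T (X + Y) Z W = c.T X Z W + c.T Y Z W := by
  simp only [T_apply, C_add_left, map_add, LinearMap.add_apply]; ring

theorem T_smul_left (f : F) (X Z W : V) : c.T (f • X) Z W = f * c.T X Z W := by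
  simp only [T_apply, C_smul_left, map_smul, LinearMap.smul_apply, smul_eq_mul]; ring

theorem T_xi_left (X Y : V) : c.T c.ξ X Y = 0 := by
  rw [T_symm, T_apply, C_xi, S_S, S_xi]; simp

theorem T_xi_right (X Y : V) : c.T X Y c.ξ = 0 := by
  rw [T_apply, g_C_xi, c.g_xi_xi]; ring

/-- `C_S` pulls `S` out of the derivative, and the adjoint `S + 2φ` carries it to the last slot. -/
theorem T_S (X Y Z : V) : c.T X (c.S Y) Z = -c.T X Y (c.S Z + (2 : F) • c.φ Z) := by
  rw [T_apply, T_apply, C_S, S_S, ← g_S, c.g_symm c.ξ (_ + _), map_add, LinearMap.add_apply,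
    map_smul, LinearMap.smul_apply, g_S_xi, g_phi_xi]
  simp

/-- The adjoint `S + 2φ` annihilates the image of `φS`. -/
theorem T_S_phi_S (X Y Z : V) : c.T X (c.S Y) (c.φ (c.S Z)) = 0 := by
  rw [T_S, S_phi_S, phi_phi_S]; simp

theorem T_phi_phi (X Y Z : V) :
    c.T X (c.φ (c.S Y)) (c.φ (c.S Z)) = -c.T X (c.S Y) (c.S Z) := by
  have h := c.T_S X (c.φ (c.S Y)) (c.S Z)
  rw [S_phi_S, S_S, zero_add, map_smul, smul_eq_mul, T_symm, T_smul_left, c.T_symm _ X] at h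
  exact c.eq_of_two_mul (by linear_combination h)

theorem g_S_S_phi (X Y : V) : c.g (c.S X) (c.S (c.φ Y)) = 2 * c.g (c.S X) Y := by
  rw [g_S, g_S, S_S, zero_add, c.phi_S_phi]
  simp only [map_add, map_smul, smul_eq_mul]

/-- This is `phi_N_add` paired with `Y`, with `∇φ` rewritten by `g_C_sub`; the correction term in
`T` absorbs the contributions of `ξ`. -/
theorem T_phi_sub (X Y Z : V) :
    c.T X (c.φ Y) Z - c.T X Z (c.φ Y) = c.T X Y (c.φ Z) - c.T X (c.φ Z) Y := by
  have h := congrArg (c.g Y) (c.phi_N_add X Z)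
  have h1 := c.g_C_sub X (c.φ Y) Z
  have h2 := c.g_C_sub X Y (c.φ Z)
  have h3 := c.g_phi Y (c.N X Z)
  simp only [map_add, map_smul, smul_eq_mul] at h
  simp only [T_apply, g_S_S_phi, c.g_symm c.ξ, g_phi_xi]
  rw [c.g_symm Z (c.S X), c.g_symm Y (c.S X)] at h
  linear_combination h1 - h2 + 2 * h3 - 2 * h

theorem T_phi_skew (X Y Z : V) :
    c.T X (c.φ (c.S Y)) (c.S Z) = -c.T X (c.φ (c.S Z)) (c.S Y) := by
  have h := c.T_phi_sub X (c.S Y) (c.S Z)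
  rw [T_S_phi_S, T_S_phi_S] at h
  linear_combination h

/-- By `T_phi_phi` the form equals `-T (φSX) (φSY) (φSZ)`, hence is symmetric in `X, Y`; by
`T_phi_skew` it is skew in `X, Z`. Such a form is zero. -/
theorem T_phi_S_S (X Y Z : V) : c.T (c.φ (c.S X)) (c.S Y) (c.S Z) = 0 := by
  have s12 (X Y Z : V) :
      c.T (c.φ (c.S X)) (c.S Y) (c.S Z) = c.T (c.φ (c.S Y)) (c.S X) (c.S Z) := by
    linear_combination c.T_phi_phi (c.φ (c.S X)) Y Z - c.T_phi_phi (c.φ (c.S Y)) X Z -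
      c.T_symm (c.φ (c.S X)) (c.φ (c.S Y)) (c.φ (c.S Z))
  have s13 (X Y Z : V) :
      c.T (c.φ (c.S X)) (c.S Y) (c.S Z) = -c.T (c.φ (c.S Z)) (c.S Y) (c.S X) := by
    rw [T_symm, T_phi_skew, T_symm]
  refine c.two_regular _ ?_
  -- Six alternating swaps return to the original order, and the three skew ones leave a total sign
  -- of -1.
  linear_combination s13 X Y Z - s12 Z Y X - s13 Y Z X + s12 X Z Y + s13 Z X Y
    - s12 Y X Z

/-- Again symmetric in one pair of arguments and skew in an overlapping pair. -/
theorem T_phi_phi_S (X Y Z : V) : c.T (c.φ (c.S X)) (c.φ (c.S Y)) (c.S Z) = 0 := by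
  have s12 (X Y Z : V) := c.T_symm (c.φ (c.S X)) (c.φ (c.S Y)) (c.S Z)
  have s23 (X Y Z : V) := c.T_phi_skew (c.φ (c.S X)) Y Z
  refine c.two_regular _ ?_
  linear_combination s23 X Y Z - s12 X Z Y - s23 Z X Y + s12 Z Y X + s23 Y Z X - s12 Y X Z

theorem T_S_S_S (X Y Z : V) : c.T (c.S X) (c.S Y) (c.S Z) = 0 := by
  have h := c.T_phi_phi (c.S X) Y Z
  rw [T_symm, T_S_phi_S] at h
  linear_combination h

theorem T_eq_zero_of_left {Y Z : V} (h1 : ∀ X, c.T (c.S X) Y Z = 0)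
    (h2 : ∀ X, c.T (c.φ (c.S X)) Y Z = 0) (X : V) : c.T X Y Z = 0 := by
  refine c.two_regular _ ?_
  rw [← T_smul_left, c.two_smul_eq]
  simp only [T_add_left, T_smul_left, T_xi_left, h1, h2]
  ring

theorem T_eq_zero_of_right {X Y : V} (h1 : ∀ Z, c.T X Y (c.S Z) = 0)
    (h2 : ∀ Z, c.T X Y (c.φ (c.S Z)) = 0) (Z : V) : c.T X Y Z = 0 := by
  refine c.two_regular _ ?_
  rw [← smul_eq_mul, ← map_smul, c.two_smul_eq]
  simp [T_xi_right, h1, h2]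

/-- By `two_smul_eq` each slot need only be tested on the images of `S` and `φS`, since `ξ`
contributes nothing; this leaves eight cases. -/
theorem T_eq_zero (X Y Z : V) : c.T X Y Z = 0 := by
  refine c.T_eq_zero_of_left (fun X ↦ ?_) (fun X ↦ ?_) X <;>
  rw [T_symm] <;>
  refine c.T_eq_zero_of_left (fun Y ↦ ?_) (fun Y ↦ ?_) Y <;>
  refine c.T_eq_zero_of_right (fun Z ↦ ?_) (fun Z ↦ ?_) Z
  · exact c.T_S_S_S ..
  · exact c.T_S_phi_S ..
  · exact c.T_phi_S_S ..
  · exact c.T_S_phi_S ..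
  · rw [T_symm, T_phi_S_S]
  · rw [T_symm, T_S_phi_S]
  · exact c.T_phi_phi_S ..
  · rw [T_phi_phi, T_phi_S_S, neg_zero]

theorem C_eq (X Y : V) : c.C X Y = -(c.g (c.S X) (c.S Y) • c.ξ) :=
  eq_neg_of_add_eq_zero_left <| c.g_nondeg _ fun Z ↦ c.T_eq_zero X Y Z

/-- On a flat contact metric manifold, `X ↦ ∇_X ξ` has rank at most one. -/
theorem g_smul_S (W X Y : V) : c.g (c.S X) (c.S Y) • c.S W = c.g (c.S W) (c.S Y) • c.S X := by
  -- Ricci identity for `S`: `R(W, X)(SY) - S(R(W, X)Y)` is the commutator of second derivatives of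
  -- `S`. With `C_eq`, the only surviving terms come from differentiating `ξ` itself.
  have h := c.flat W X (c.S Y)
  have h' := congrArg c.S (c.flat W X Y)
  simp only [MetricCalculus.curv, nab_S, C_eq, map_add, map_sub, map_neg, map_zero, c.nab_add,
    c.nab_neg, c.nab_smul, nab_xi, c.D_g, LinearMap.add_apply, LinearMap.sub_apply,
    LinearMap.neg_apply, LinearMap.smul_apply, map_smul] at h h'
  have hx (A : V) : c.g c.ξ (c.S A) = 0 := by rw [c.g_symm, g_S_xi]
  simp only [hx, g_S_xi] at h
  linear_combination (norm := module) h' - h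

end FlatContactCalculus

/-! ### Smooth frames, and smoothness of brackets and covariant derivatives. -/

section Calculus

variable {E : Type*} [NormedAddCommGroup E] [NormedSpace ℝ E]
  {H : Type*} [TopologicalSpace H] {I : ModelWithCorners ℝ E H}
  {M : Type*} [TopologicalSpace M] [ChartedSpace H M]

theorem contMDiffAt_det {ι : Type*} [Fintype ι] [DecidableEq ι] {G : M → Matrix ι ι ℝ} {x : M}
    (hG : ∀ i j, ContMDiffAt I 𝓘(ℝ) ∞ (fun y ↦ G y i j) x) :
    ContMDiffAt I 𝓘(ℝ) ∞ (fun y ↦ (G y).det) x := by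
  simp only [Matrix.det_apply']
  exact contMDiffAt_finsetSum fun σ _ ↦
    contMDiffAt_const.mul (contMDiffAt_finsetProd fun i _ ↦ hG _ _)

/-- Cramer's rule. -/
theorem contMDiffAt_matrix_inv {ι : Type*} [Fintype ι] [DecidableEq ι] {G : M → Matrix ι ι ℝ}
    {x : M} (hG : ∀ i j, ContMDiffAt I 𝓘(ℝ) ∞ (fun y ↦ G y i j) x) (hx : (G x).det ≠ 0) (i j : ι) :
    ContMDiffAt I 𝓘(ℝ) ∞ (fun y ↦ (G y)⁻¹ i j) x := by
  simp only [Matrix.inv_def, Ring.inverse_eq_inv', Matrix.smul_apply, smul_eq_mul,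
    Matrix.adjugate_apply]
  refine ((contMDiffAt_det hG).inv₀ hx).mul (contMDiffAt_det fun k l ↦ ?_)
  by_cases h : k = j
  · subst h; simpa using contMDiffAt_const
  · simpa [Matrix.updateRow_ne h] using hG k l

variable [IsManifold I ∞ M]

theorem contMDiff_mvfderiv_apply {f : M → ℝ} (hf : ContMDiff I 𝓘(ℝ) ∞ f)
    (X : SmoothVectorField I M) : ContMDiff I 𝓘(ℝ) ∞ (fun y ↦ d% f y (X y)) :=
  (contMDiff_snd_tangentBundle_modelSpace ℝ 𝓘(ℝ)).comp
    ((hf.contMDiff_tangentMap (by simp)).comp X.contMDiff)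

theorem contMDiff_mlieBracket [CompleteSpace E] (X Y : SmoothVectorField I M) :
    ContMDiff I (I.prod 𝓘(ℝ, E)) ∞ (T% (mlieBracket I X Y)) := by
  have : IsManifold I (((⊤ : ℕ∞) : WithTop ℕ∞) + 1) M := by simpa
  have : IsManifold I (minSmoothness ℝ 2) M := by
    rw [minSmoothness_of_isRCLikeNormedField]; infer_instance
  exact ContDiff.mlieBracket_vectorField (m := ⊤) (n := ⊤) X.contMDiff Y.contMDiff (by simp)

section Frame

variable [FiniteDimensional ℝ E] [T2Space M]

/-- Near each point there is a frame made of global smooth vector fields. -/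
theorem exists_smoothVectorField_frame (x : M) :
    ∃ s : Module.Basis.ofVectorSpaceIndex ℝ E → SmoothVectorField I M,
      ∀ᶠ y in nhds x, ∃ b : Module.Basis _ ℝ (TangentSpace I y), ∀ i, s i y = b i := by
  let e := trivializationAt E (TangentSpace I) x
  let b := Module.Basis.ofVectorSpace ℝ E
  have he : e.baseSet ∈ nhds x :=
    e.open_baseSet.mem_nhds (FiberBundle.mem_baseSet_trivializationAt' x)
  -- A bump function equal to 1 near `x` extends the local frame by zero without changing it near
  -- `x`.
  obtain ⟨f, hf, -⟩ := (SmoothBumpFunction.nhds_basis_support (I := I) he).mem_iff.1 he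
  refine ⟨fun i ↦ ⟨(f : M → ℝ) • e.localFrame b i, ContMDiffOn.smul_section_of_tsupport
    f.contMDiff.contMDiffOn e.open_baseSet hf (e.contMDiffOn_localFrame_baseSet _ b i)⟩, ?_⟩
  filter_upwards [he, f.eventuallyEq_one] with y hy hfy
  refine ⟨e.basisAt b hy, fun i ↦ ?_⟩
  change f y • e.localFrame b i y = _
  rw [hfy, e.localFrame_apply_of_mem_baseSet b hy]
  exact one_smul ℝ _

/-- This turns identities between vector fields into identities between tangent vectors at `x`. -/
theorem exists_smoothVectorField_eq (x : M) (v : TangentSpace I x) :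
    ∃ X : SmoothVectorField I M, X x = v := by
  obtain ⟨s, hs⟩ := exists_smoothVectorField_frame (I := I) x
  obtain ⟨b, hb⟩ := hs.self_of_nhds
  let L : SmoothVectorField I M →ₗ[ℝ] TangentSpace I x :=
    { toFun X := X x, map_add' _ _ := rfl, map_smul' _ _ := rfl }
  have h : (⊤ : Submodule ℝ _) ≤ L.range := by
    rw [← b.span_eq, Submodule.span_le]
    rintro _ ⟨i, rfl⟩
    exact ⟨s i, hb i⟩
  exact h (Submodule.mem_top (x := v))

end Frame

variable [RiemannianBundle (fun x : M ↦ TangentSpace I x)]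
  [IsContMDiffRiemannianBundle I ∞ E (fun x : M ↦ TangentSpace I x)]

theorem contMDiff_inner (X Y : SmoothVectorField I M) :
    ContMDiff I 𝓘(ℝ) ∞ (fun y ↦ (inner ℝ (X y) (Y y) : ℝ)) :=
  ContMDiff.inner_bundle (F := E) (E := fun x : M ↦ TangentSpace I x) (b := fun y : M ↦ y)
    X.contMDiff Y.contMDiff

variable [FiniteDimensional ℝ E] [T2Space M]

/-- A vector field is smooth if its inner products with smooth vector fields are. -/
theorem contMDiff_of_inner {V : Π x : M, TangentSpace I x}
    (hV : ∀ Z : SmoothVectorField I M, ContMDiff I 𝓘(ℝ) ∞ (fun y ↦ (inner ℝ (Z y) (V y) : ℝ))) :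
    ContMDiff I (I.prod 𝓘(ℝ, E)) ∞ (T% V) := by
  classical
  intro x
  obtain ⟨s, hs⟩ := exists_smoothVectorField_frame (I := I) x
  -- The frame coefficients of `V` solve a linear system with the Gram matrix and the smooth right
  -- side `g(s j, V)`, so inverting the matrix shows that they are smooth.
  let G (y : M) := Matrix.gram ℝ (fun i ↦ s i y)
  have hG i j : ContMDiffAt I 𝓘(ℝ) ∞ (fun y ↦ G y i j) x := contMDiff_inner (s i) (s j) x
  have hdet : ∀ᶠ y in nhds x, (G y).det ≠ 0 := by
    filter_upwards [hs] with y ⟨b, hb⟩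
    rw [Matrix.det_gram_ne_zero_iff_linearIndependent]
    simpa only [hb] using b.linearIndependent
  have hsum : ContMDiffAt I (I.prod 𝓘(ℝ, E)) ∞ (T% fun y ↦
      ∑ i, ((fun y ↦ ∑ j, (G y)⁻¹ i j * (inner ℝ (s j y) (V y) : ℝ)) • ⇑(s i)) y) x :=
    ContMDiffAt.sum_section fun i _ ↦ ContMDiffAt.smul_section
      (contMDiffAt_finsetSum fun j _ ↦
        (contMDiffAt_matrix_inv hG hdet.self_of_nhds i j).mul (hV (s j) x)) (s i).contMDiff.contMDiffAt
  refine hsum.congr_of_eventuallyEq ?_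
  filter_upwards [hs, hdet] with y ⟨b, hb⟩ hy
  congr 1
  have e : (fun j ↦ (inner ℝ (s j y) (V y) : ℝ)) = Matrix.mulVec (G y) (b.repr (V y)) := by
    ext j
    conv_lhs => rw [← b.sum_repr (V y), inner_sum]
    simp only [Matrix.mulVec, dotProduct, inner_smul_right, G, Matrix.gram_apply, hb]
    exact Finset.sum_congr rfl fun i _ ↦ mul_comm _ _
  have e' i : ∑ j, (G y)⁻¹ i j * (inner ℝ (s j y) (V y) : ℝ) = b.repr (V y) i := by
    have := congrFun (congrArg (Matrix.mulVec (G y)⁻¹) e) i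
    rwa [Matrix.mulVec_mulVec, Matrix.nonsing_inv_mul _ (isUnit_iff_ne_zero.2 hy),
      Matrix.one_mulVec] at this
  conv_lhs => rw [← b.sum_repr (V y)]
  refine Finset.sum_congr rfl fun i _ ↦ ?_
  rw [← e', ← hb]
  rfl

variable [CompleteSpace E]

/-- The Koszul formula expresses the products of `∇_X Y` with smooth fields by smooth functions. -/
theorem contMDiff_nabla (X Y : SmoothVectorField I M) :
    ContMDiff I (I.prod 𝓘(ℝ, E)) ∞ (T% (nabla I X Y)) := by
  refine contMDiff_of_inner fun Z ↦ ?_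
  have h y : (inner ℝ (Z y) (nabla I X Y y) : ℝ) = koszul (Y : Π x : M, TangentSpace I x) X Z y / 2 := by
    rw [real_inner_comm]
    exact inner_leviCivitaFun Y.mdifferentiableAt X.mdifferentiableAt Z.mdifferentiableAt
  simp only [h, koszul, div_eq_mul_inv]
  have br (A B C : SmoothVectorField I M) :=
    contMDiff_inner A ⟨mlieBracket I B C, contMDiff_mlieBracket B C⟩
  exact ((((((contMDiff_mvfderiv_apply (contMDiff_inner Y Z) X).add
    (contMDiff_mvfderiv_apply (contMDiff_inner Z X) Y)).sub
    (contMDiff_mvfderiv_apply (contMDiff_inner X Y) Z)).sub (br X Y Z)).sub (br Y X Z)).add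
    (br Z X Y)).mul contMDiff_const

end Calculus

/-! ### The geometric structures as instances of the algebraic ones, and the dimension bounds. -/

section Model

variable {E : Type*} [NormedAddCommGroup E] [NormedSpace ℝ E]
  {H : Type*} [TopologicalSpace H] {I : ModelWithCorners ℝ E H}
  {M : Type*} [TopologicalSpace M] [ChartedSpace H M] [IsManifold I ∞ M]

/-- Smooth vector fields form a module over the ring of smooth functions. -/
instance : Module C^∞⟮I, M; 𝓘(ℝ, ℝ), ℝ⟯ (SmoothVectorField I M) where
  smul f X := ⟨(f : M → ℝ) • ⇑X, f.contMDiff.smul_section X.contMDiff⟩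
  one_smul X := by ext x; exact one_smul ℝ (X x)
  mul_smul f h X := by ext x; exact mul_smul (f x) (h x) (X x)
  smul_zero f := by ext x; exact smul_zero (f x)
  smul_add f X Y := by ext x; exact smul_add (f x) (X x) (Y x)
  add_smul f h X := by ext x; exact add_smul (f x) (h x) (X x)
  zero_smul X := by ext x; exact zero_smul ℝ (X x)

/-- A smooth endomorphism of the tangent bundle acts on smooth vector fields. -/
def IsSmoothEndomorphism.toLinearMap {φ : Π x : M, TangentSpace I x →L[ℝ] TangentSpace I x}
    (hφ : IsSmoothEndomorphism I φ) :
    SmoothVectorField I M →ₗ[C^∞⟮I, M; 𝓘(ℝ, ℝ), ℝ⟯] SmoothVectorField I M where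
  toFun X := ⟨fun x ↦ φ x (X x), fun x ↦ ContMDiffAt.clm_bundle_apply (b := fun y : M ↦ y)
    (F₁ := E) (F₂ := E) (E₁ := fun x : M ↦ TangentSpace I x)
    (E₂ := fun x : M ↦ TangentSpace I x) (hφ x) (X.contMDiff x)⟩
  map_add' X Y := by ext x; exact (φ x).map_add (X x) (Y x)
  map_smul' f X := by ext x; exact (φ x).map_smul (f x) (X x)

variable [FiniteDimensional ℝ E] [CompleteSpace E] [T2Space M]
  [RiemannianBundle (fun x : M ↦ TangentSpace I x)]
  [IsContMDiffRiemannianBundle I ∞ E (fun x : M ↦ TangentSpace I x)]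

variable (I M) in
/-- The Levi-Civita connection of `M` acting on smooth vector fields. -/
def leviCivitaCalculus :
    MetricCalculus C^∞⟮I, M; 𝓘(ℝ, ℝ), ℝ⟯ (SmoothVectorField I M) where
  g := LinearMap.mk₂ _ (fun X Y ↦ ⟨fun x ↦ inner ℝ (X x) (Y x), contMDiff_inner X Y⟩)
    (fun X Y Z ↦ by ext x; exact inner_add_left (𝕜 := ℝ) (X x) (Y x) (Z x))
    (fun f X Y ↦ by ext x; exact real_inner_smul_left (X x) (Y x) (f x))
    (fun X Y Z ↦ by ext x; exact inner_add_right (𝕜 := ℝ) (X x) (Y x) (Z x))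
    (fun f X Y ↦ by ext x; exact real_inner_smul_right (X x) (Y x) (f x))
  D X f := ⟨fun x ↦ d% f x (X x), contMDiff_mvfderiv_apply f.contMDiff X⟩
  nab X Y := ⟨nabla I X Y, contMDiff_nabla X Y⟩
  g_symm X Y := by ext x; exact real_inner_comm (Y x) (X x)
  g_nondeg X h := by
    ext x
    exact inner_self_eq_zero.1 (congrArg (fun f : C^∞⟮I, M; 𝓘(ℝ, ℝ), ℝ⟯ ↦ f x) (h X))
  two_regular f h := by
    ext x
    have : f x + f x = 0 := by
      rw [two_mul] at h
      exact congrArg (fun f : C^∞⟮I, M; 𝓘(ℝ, ℝ), ℝ⟯ ↦ f x) h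
    change f x = 0
    linarith
  D_add X f h := by
    ext x
    exact congrArg (fun L : TangentSpace I x →L[ℝ] ℝ ↦ L (X x))
      (mvfderiv_add f.mdifferentiableAt h.mdifferentiableAt)
  D_one X := by
    ext x
    exact congrArg (fun L : TangentSpace I x →L[ℝ] ℝ ↦ L (X x)) (mvfderiv_const (1 : ℝ))
  nab_add_left X Y Z := by ext x; exact (leviCivita I M Z x).map_add (X x) (Y x)
  nab_smul_left f X Z := by ext x; exact (leviCivita I M Z x).map_smul (f x) (X x)
  nab_add X Y Z := by
    ext x
    exact congrArg (fun L : TangentSpace I x →L[ℝ] TangentSpace I x ↦ L (X x))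
      ((leviCivita I M).isCovariantDerivativeOnUniv.add Y.mdifferentiableAt Z.mdifferentiableAt)
  nab_smul X f Z := by
    ext x
    exact congrArg (fun L : TangentSpace I x →L[ℝ] TangentSpace I x ↦ L (X x))
      ((leviCivita I M).isCovariantDerivativeOnUniv.leibniz Z.mdifferentiableAt
        f.mdifferentiableAt)
  D_g X Y Z := by
    ext x
    exact leviCivita_metric X.mdifferentiableAt Y.mdifferentiableAt Z.mdifferentiableAt

theorem mlieBracket_eq_sub (X Y : SmoothVectorField I M) :
    mlieBracket I X Y =
      ⇑((leviCivitaCalculus I M).nab X Y - (leviCivitaCalculus I M).nab Y X) := by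
  ext1 x
  exact ((CovariantDerivative.torsion_eq_zero_iff _).1 leviCivita_torsion
    X.mdifferentiableAt Y.mdifferentiableAt).symm

theorem curvature_eq (X Y Z : SmoothVectorField I M) :
    curvature I X Y Z = ⇑((leviCivitaCalculus I M).curv X Y Z) := by
  ext1 x
  rw [curvature, mlieBracket_eq_sub]
  rfl

theorem nablaCurvature_eq (W X Y Z : SmoothVectorField I M) :
    nablaCurvature I W X Y Z = ⇑((leviCivitaCalculus I M).nabCurv W X Y Z) := by
  ext1 x
  have h1 := congrFun (curvature_eq ((leviCivitaCalculus I M).nab W X) Y Z) x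
  have h2 := congrFun (curvature_eq X ((leviCivitaCalculus I M).nab W Y) Z) x
  have h3 := congrFun (curvature_eq X Y ((leviCivitaCalculus I M).nab W Z)) x
  rw [nablaCurvature, curvature_eq]
  exact congrArg₂ _ (congrArg₂ _ (congrArg₂ _ rfl h1) h2) h3

theorem HasConstantCurvature.curv_eq {c : ℝ} (h : HasConstantCurvature I M c)
    (X Y Z : SmoothVectorField I M) :
    (leviCivitaCalculus I M).curv X Y Z =
      (ContMDiffMap.const c : C^∞⟮I, M; 𝓘(ℝ, ℝ), ℝ⟯) •
        ((leviCivitaCalculus I M).g Y Z • X - (leviCivitaCalculus I M).g X Z • Y) := by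
  ext x
  rw [← curvature_eq, h]
  rfl

/-- Manifolds of constant curvature are locally symmetric. -/
theorem HasConstantCurvature.nablaCurvature_eq_zero {c : ℝ} (h : HasConstantCurvature I M c)
    (W X Y Z : SmoothVectorField I M) (x : M) : nablaCurvature I W X Y Z x = 0 := by
  rw [nablaCurvature_eq, MetricCalculus.nabCurv_eq_zero _ (fun X ↦ ?_) h.curv_eq]
  · rfl
  · ext x
    exact congrArg (fun L : TangentSpace I x →L[ℝ] ℝ ↦ L (X x)) (mvfderiv_const c)

variable {n : ℕ} {η : Π x : M, TangentSpace I x →L[ℝ] ℝ} {ξ : SmoothVectorField I M}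
  {φ : Π x : M, TangentSpace I x →L[ℝ] TangentSpace I x}

theorem IsContactMetricStructure.inner_xi_xi (hM : IsContactMetricStructure I n η ξ φ) (x : M) :
    (inner ℝ (ξ x) (ξ x) : ℝ) = 1 := by
  rw [← hM.eta_eq, hM.eta_xi]

/-- Since `η = g(·, ξ)`, metric compatibility expands `X(η(Y))` and `Y(η(X))`; torsion-freeness
cancels the terms that do not differentiate `ξ`. -/
theorem IsContactMetricStructure.two_mul_extDerivOneForm
    (hM : IsContactMetricStructure I n η ξ φ) (X Y : SmoothVectorField I M) (x : M) :
    2 * extDerivOneForm I η X Y x =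
      inner ℝ (nabla I X ξ x) (Y x) - inner ℝ (nabla I Y ξ x) (X x) := by
  have h1 := leviCivita_metric (x := x) X.mdifferentiableAt Y.mdifferentiableAt
    ξ.mdifferentiableAt
  have h2 := leviCivita_metric (x := x) Y.mdifferentiableAt X.mdifferentiableAt
    ξ.mdifferentiableAt
  have h3 := (CovariantDerivative.torsion_eq_zero_iff _).1 leviCivita_torsion
    (X.mdifferentiableAt (x := x)) Y.mdifferentiableAt
  simp only [extDerivOneForm, hM.eta_eq]
  rw [h1, h2, ← h3, inner_sub_left, real_inner_comm (Y x), real_inner_comm (X x)]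
  simp only [nabla]
  ring

/-- The contact metric structure of a flat manifold, acting on smooth vector fields. -/
def IsContactMetricStructure.calculus (hM : IsContactMetricStructure I n η ξ φ)
    (h : HasConstantCurvature I M 0) :
    FlatContactCalculus C^∞⟮I, M; 𝓘(ℝ, ℝ), ℝ⟯ (SmoothVectorField I M) where
  toMetricCalculus := leviCivitaCalculus I M
  ξ := ξ
  φ := hM.smooth_phi.toLinearMap
  flat X Y Z := by
    rw [h.curv_eq]
    exact zero_smul _ _
  g_xi_xi := by ext x; exact hM.inner_xi_xi x
  deta X Y := by
    rw [two_mul]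
    ext x
    refine (hM.two_mul_extDerivOneForm X Y x).symm.trans ?_
    rw [hM.deta_eq, two_mul]
    rfl
  deta_xi X := by
    ext x
    refine (hM.two_mul_extDerivOneForm ξ X x).symm.trans ?_
    rw [hM.deta_xi, mul_zero]
    rfl
  phi_sq X := by
    ext x
    refine (hM.phi_sq x (X x)).trans ?_
    rw [hM.eta_eq]
    rfl

/-- A flat contact metric manifold has dimension at most three. -/
theorem IsContactMetricStructure.finrank_le_three (hM : IsContactMetricStructure I n η ξ φ)
    (h : HasConstantCurvature I M 0) (x : M) : Module.finrank ℝ (TangentSpace I x) ≤ 3 := by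
  let c := hM.calculus h
  let S := leviCivita I M ξ x
  have hS (u : TangentSpace I x) :
      (2 : ℝ) • u = S (φ x u) + φ x (S u) + (2 : ℝ) • (inner ℝ u (ξ x) : ℝ) • ξ x := by
    obtain ⟨X, rfl⟩ := exists_smoothVectorField_eq x u
    have e := c.two_smul_eq X
    -- Writing the constant function 2 as a sum lets the identity be evaluated at `x` directly.
    rw [two_smul, two_smul] at e
    have := congrArg (fun Y : SmoothVectorField I M ↦ Y x) e
    simp only [two_smul]
    exact this
  have hr (u v : TangentSpace I x) :
      (inner ℝ (S u) (S u) : ℝ) • S v = (inner ℝ (S v) (S u) : ℝ) • S u := by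
    obtain ⟨X, rfl⟩ := exists_smoothVectorField_eq x u
    obtain ⟨Y, rfl⟩ := exists_smoothVectorField_eq x v
    exact congrArg (fun Y : SmoothVectorField I M ↦ Y x) (c.g_smul_S Y X X)
  -- Any nonzero value of `S` spans its image, by `hr`; if `S` vanishes at `x`, then `e = 0` serves.
  obtain ⟨e, he⟩ : ∃ e, ∀ v, ∃ t : ℝ, S v = t • e := by
    by_cases h0 : ∃ u, S u ≠ 0
    · obtain ⟨u, hu⟩ := h0
      have hu' : (inner ℝ (S u) (S u) : ℝ) ≠ 0 := inner_self_ne_zero.2 hu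
      refine ⟨S u, fun v ↦ ⟨(inner ℝ (S u) (S u))⁻¹ * inner ℝ (S v) (S u), ?_⟩⟩
      rw [mul_smul, ← hr, inv_smul_smul₀ hu']
    · push Not at h0
      exact ⟨0, fun v ↦ ⟨0, by rw [h0, smul_zero]⟩⟩
  have htop : Submodule.span ℝ (Set.range ![e, φ x e, ξ x]) = ⊤ := by
    refine eq_top_iff.2 fun u _ ↦ ?_
    have hm (i : Fin 3) : ![e, φ x e, ξ x] i ∈ Submodule.span ℝ (Set.range ![e, φ x e, ξ x]) :=
      Submodule.subset_span ⟨i, rfl⟩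
    rw [← inv_smul_smul₀ (two_ne_zero (α := ℝ)) u, hS]
    obtain ⟨s, hs⟩ := he (φ x u)
    obtain ⟨t, ht⟩ := he u
    rw [hs, ht, map_smul]
    exact Submodule.smul_mem _ _ (add_mem (add_mem (Submodule.smul_mem _ _ (hm 0))
      (Submodule.smul_mem _ _ (hm 1)))
      (Submodule.smul_mem _ _ (Submodule.smul_mem _ _ (hm 2))))
  rw [← finrank_top, ← htop]
  exact finrank_range_le_card _

/-- If the curvature tensor of a contact metric manifold of constant curvature `c ≠ 0` vanishes at
some point, then the manifold is at most one-dimensional. -/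
theorem IsContactMetricStructure.finrank_le_one (hM : IsContactMetricStructure I n η ξ φ) {c : ℝ}
    (h : HasConstantCurvature I M c) (hc : c ≠ 0) (x : M)
    (hx : ∀ X Y Z : SmoothVectorField I M, curvature I X Y Z x = 0) :
    Module.finrank ℝ (TangentSpace I x) ≤ 1 := by
  refine _root_.finrank_le_one (ξ x) fun v ↦ ⟨inner ℝ v (ξ x), ?_⟩
  obtain ⟨X, rfl⟩ := exists_smoothVectorField_eq x v
  -- Since `g(ξ, ξ) = 1`, this says `c (X - g(X, ξ) ξ) = 0` at `x`.
  have := hx X ξ ξ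
  rw [h, hM.inner_xi_xi, one_smul] at this
  exact (sub_eq_zero.1 ((smul_eq_zero.1 this).resolve_left hc)).symm

end Model

end ContactGeometry

end

/-! ### The main theorem. -/

theorem theorem4p3 (n : ℕ) (hn : 1 < n)
    {M : Type*} [TopologicalSpace M] [T2Space M]
    [ChartedSpace (EuclideanSpace ℝ (Fin (2 * n + 1))) M] [IsManifold (𝓡 (2 * n + 1)) ∞ M]
    [RiemannianBundle (fun x : M ↦ TangentSpace (𝓡 (2 * n + 1)) x)]
    [IsContMDiffRiemannianBundle (𝓡 (2 * n + 1)) ∞ (EuclideanSpace ℝ (Fin (2 * n + 1)))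
      (fun x : M ↦ TangentSpace (𝓡 (2 * n + 1)) x)]
    (η : Π x : M, TangentSpace (𝓡 (2 * n + 1)) x →L[ℝ] ℝ)
    (ξ : ContactGeometry.SmoothVectorField (𝓡 (2 * n + 1)) M)
    (φ : Π x : M, TangentSpace (𝓡 (2 * n + 1)) x →L[ℝ] TangentSpace (𝓡 (2 * n + 1)) x)
    (hM : ContactGeometry.IsContactMetricStructure (𝓡 (2 * n + 1)) n η ξ φ)
    (hc : ∃ c : ℝ, ContactGeometry.HasConstantCurvature (𝓡 (2 * n + 1)) M c) :
    ¬ ContactGeometry.IsPhiRecurrent (𝓡 (2 * n + 1)) φ := by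
  rintro ⟨A, -, ⟨x, hA⟩, h⟩
  obtain ⟨c, hc⟩ := hc
  have hdim : Module.finrank ℝ (TangentSpace (𝓡 (2 * n + 1)) x) = 2 * n + 1 :=
    finrank_euclideanSpace_fin (𝕜 := ℝ)
  obtain ⟨w, hw⟩ : ∃ w, A x w ≠ 0 := by
    by_contra! h0
    exact hA (ContinuousLinearMap.ext h0)
  obtain ⟨W, rfl⟩ := ContactGeometry.exists_smoothVectorField_eq x w
  have hx (X Y Z : ContactGeometry.SmoothVectorField (𝓡 (2 * n + 1)) M) :
      ContactGeometry.curvature (𝓡 (2 * n + 1)) X Y Z x = 0 := by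
    have e := h X Y Z W x
    rw [hc.nablaCurvature_eq_zero, map_zero, map_zero] at e
    exact (smul_eq_zero.1 e.symm).resolve_left hw
  -- Here `2n + 1 ≥ 5`, which exceeds both dimension bounds; the flat case is the one that needs `n
  -- > 1` rather than `n > 0`.
  by_cases h0 : c = 0
  · subst h0
    have := hM.finrank_le_three hc x
    omega
  · have := hM.finrank_le_one hc h0 x hx
    omega
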